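/- Let $n,k$ be integers with $1\le k\le n$. A $k$-shuffle of a deck of $n$ cards takes any $k$ cards in the deck and moves them to the top, preserving their relative order and the relative order of the remaining cards; it is regarded as a permutation in $S_n$ of the $n$ positions (the card in position $i$ moves to position $i\sigma$), and there are $\binom nk$ of them. Let $P(k)$ be the transition matrix of the Markov chain on $S_n$ in which each step is given by applying one of the $\binom nk$ $k$-shuffles, chosen uniformly at random: with permutations acting on the right, $P(k)_{\sigma\tau}=\binom nk^{-1}$ if $\sigma^{-1}\tau$ is a $k$-shuffle, and $P(k)_{\sigma\tau}=0$ otherwise. For $\tau\in S_n$ let $\pi_k(\tau)$ be the number of $k$-subsets $A$ of $\{1,\dots,n\}$ with $\tau(A)=A$. Then the multiset of the $n!$ eigenvalues of $P(k)$ over $\mathbb C$, counted with algebraic multiplicity, is $$\Bigl\{\pi_k(\tau)\big/\tbinom nk : \tau\in S_n\Bigr\}.$$ Suppose moreover that $n\ge2$ and $k<n$, and let $P'(k)$ be the transition matrix of the modified chain in which each step is given by one of the $\binom nk-1$ non-identity $k$-shuffles, chosen uniformly at random. Then the multiset of the $n!$ eigenvalues of $P'(k)$ over $\mathbb C$, counted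 with algebraic multiplicity, is $$\Bigl\{(\pi_k(\tau)-1)\big/\bigl(\tbinom nk-1\bigr) : \tau\in S_n\Bigr\}.$$ -/

import Mathlib

/-- A permutation `s` of the positions `0, …, n - 1` of a deck of `n` cards (position `0` is the top;
the card in position `i` moves to position `s i`) is a `k`-shuffle if it moves some `k` cards,
those in the positions `A`, to the top `k` positions, preserving the relative order
of these cards as well as the relative order of the remaining ones. -/
def IsKShuffle (n k : ℕ) (s : Equiv.Perm (Fin n)) : Prop :=
  ∃ A : Finset (Fin n), A.card = k ∧ (∀ i ∈ A, (s i : ℕ) < k) ∧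
    StrictMonoOn s (A : Set (Fin n)) ∧ StrictMonoOn s ((A : Set (Fin n))ᶜ)

open Classical in
/-- The finite set of all `k`-shuffles of a deck of `n` cards. -/
noncomputable def kShuffles (n k : ℕ) : Finset (Equiv.Perm (Fin n)) :=
  Finset.univ.filter (IsKShuffle n k)

/-- The transition matrix of the Markov chain on the symmetric group in which each step applies
an element of `S` chosen uniformly at random. The arrangement `σ` followed by the shuffle `s` is
`s * σ`, as Lean composes permutations from right to left (with permutations acting
on the right this product is written `σ s`). -/
noncomputable def uniformChain {n : ℕ} (S : Finset (Equiv.Perm (Fin n))) :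
    Matrix (Equiv.Perm (Fin n)) (Equiv.Perm (Fin n)) ℝ :=
  Matrix.of fun σ τ => if τ * σ⁻¹ ∈ S then ((S.card : ℝ))⁻¹ else 0

/-- The transition matrix of the uniform `k`-shuffle chain. -/
noncomputable def kShuffleMatrix (n k : ℕ) :
    Matrix (Equiv.Perm (Fin n)) (Equiv.Perm (Fin n)) ℝ :=
  uniformChain (kShuffles n k)

/-- The transition matrix of the chain in which each step applies a uniformly chosen
non-identity `k`-shuffle. -/
noncomputable def kShuffleMatrix' (n k : ℕ) :
    Matrix (Equiv.Perm (Fin n)) (Equiv.Perm (Fin n)) ℝ :=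
  uniformChain ((kShuffles n k).erase 1)

/-- The number of `k`-subsets `A` with `τ(A) = A`. -/
def fixedKSubsets {n : ℕ} (k : ℕ) (τ : Equiv.Perm (Fin n)) : ℕ :=
  ((Finset.univ.powersetCard k).filter fun A : Finset (Fin n) => A.image τ = A).card

/-- The complex eigenvalues of a real square matrix, with algebraic multiplicity. -/
noncomputable def eigenvalueMultiset {ι : Type*} [Fintype ι] [DecidableEq ι]
    (M : Matrix ι ι ℝ) : Multiset ℂ :=
  (M.map (algebraMap ℝ ℂ)).charpoly.roots

/-! Track sets of cards rather than positions: a `k`-shuffle moves a `k`-set of cards to the top.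
The trace of the `m`-th power of the 0/1 transition matrix counts pairs of a word of `m` such sets
and an arrangement it fixes. A word sorts the cards by their membership pattern in its sets,
breaking ties by the old order. Its fixed arrangements are those already sorted, as numerous as the
permutations preserving every set of the word (`card_fixed_foldr_moveToTop`). Exchanging sums, the
trace is `∑ τ, (fixedKSubsets k τ) ^ m`. In characteristic zero power sums determine the spectrum
(`Multiset.eq_of_sum_map_pow_eq`). Both chains are linear polynomials in this matrix. -/

open Polynomial in
theorem Matrix.det_aeval_eq_prod_roots_charpoly {K ι : Type*} [Field K] [IsAlgClosed K]
    [Fintype ι] [DecidableEq ι] (M : Matrix ι ι K) (p : K[X]) :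
    (aeval M p).det = (M.charpoly.roots.map fun x => p.eval x).prod := by
  have hcard : M.charpoly.roots.card = Fintype.card ι := by
    rw [← (IsAlgClosed.splits M.charpoly).natDegree_eq_card_roots, M.charpoly_natDegree_eq_dim]
  have hlin : ∀ a : K, (aeval M (X - C a)).det =
      (M.charpoly.roots.map fun x => (X - C a).eval x).prod := by
    intro a
    have h1 : (aeval M (X - C a)).det = (-1) ^ Fintype.card ι * M.charpoly.eval a := by
      rw [Matrix.eval_charpoly, ← Matrix.det_neg]
      congr 1
      simp [Matrix.algebraMap_eq_diagonal, Matrix.scalar_apply, Pi.algebraMap_def]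
    rw [h1, (IsAlgClosed.splits M.charpoly).eval_eq_prod_roots_of_monic M.charpoly_monic,
      ← hcard]
    simp only [eval_sub, eval_X, eval_C]
    rw [← Multiset.card_map (fun x => a - x), ← Multiset.prod_map_neg, Multiset.map_map]
    simp
  -- Both sides are multiplicative in `p`, so linear factors and the leading constant suffice.
  rw [(IsAlgClosed.splits p).eq_prod_roots]
  generalize p.roots = s
  induction s using Multiset.induction with
  | empty =>
    simp [Matrix.algebraMap_eq_diagonal, Pi.algebraMap_def, hcard]
  | cons a s ih =>
    have : C p.leadingCoeff * (Multiset.map (fun x => X - C x) (a ::ₘ s)).prod =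
      (X - C a) * (C p.leadingCoeff * (Multiset.map (fun x => X - C x) s).prod) := by
      rw [Multiset.map_cons, Multiset.prod_cons]; ring
    rw [this, map_mul, Matrix.det_mul, ih, hlin, ← Multiset.prod_map_mul]
    simp only [eval_mul]

-- The determinant formula for `C a - p` evaluates the characteristic polynomial of `p(M)` at every
-- `a`.
open Polynomial in
theorem Matrix.roots_charpoly_aeval {K ι : Type*} [Field K] [IsAlgClosed K]
    [Fintype ι] [DecidableEq ι] (M : Matrix ι ι K) (p : K[X]) :
    (aeval M p).charpoly.roots = M.charpoly.roots.map fun x => p.eval x := by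
  have : (aeval M p).charpoly = ((M.charpoly.roots.map fun x => p.eval x).map
      fun x => X - C x).prod := by
    refine Polynomial.funext fun a => ?_
    rw [Matrix.eval_charpoly]
    have h := M.det_aeval_eq_prod_roots_charpoly (C a - p)
    rw [map_sub, aeval_C] at h
    rw [eval_multiset_prod, Multiset.map_map, Multiset.map_map]
    simpa [Matrix.algebraMap_eq_diagonal, Matrix.scalar_apply, Pi.algebraMap_def] using h
  rw [this, roots_multiset_prod_X_sub_C]

-- By linearity the sums of any polynomial over `s` and `t` agree; a Lagrange basis polynomial, 1 at
-- `a` and 0 at the other elements, reads off the multiplicity of `a`.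
open Polynomial in
theorem Multiset.eq_of_sum_map_pow_eq {K : Type*} [Field K] [CharZero K] {s t : Multiset K}
    (h : ∀ m : ℕ, (s.map (· ^ m)).sum = (t.map (· ^ m)).sum) : s = t := by
  classical
  have hp : ∀ p : K[X], (s.map p.eval).sum = (t.map p.eval).sum := by
    intro p
    induction p using Polynomial.induction_on' with
    | add p q hp hq =>
      simp only [eval_add, Multiset.sum_map_add]
      exact congrArg₂ _ hp hq
    | monomial m a => simp only [eval_monomial, Multiset.sum_map_mul_left, h]
  ext a
  let p : K[X] := Lagrange.basis (insert a (s + t).toFinset) id a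
  have hq : ∀ u : Multiset K, u ≤ s + t → (u.map p.eval).sum = u.count a := by
    intro u hu
    have : u.map p.eval = u.map fun x => if a = x then (1 : K) else 0 := by
      refine Multiset.map_congr rfl fun x hx => ?_
      split_ifs with hax
      · subst hax
        exact Lagrange.eval_basis_self (Function.injective_id.injOn) (Finset.mem_insert_self _ _)
      · exact Lagrange.eval_basis_of_ne (v := id) hax
          (Finset.mem_insert_of_mem (Multiset.mem_toFinset.2 (Multiset.mem_of_le hu hx)))
    rw [this]
    clear this hu
    induction u using Multiset.induction with
    | empty => simp
    | cons b u ih =>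
      rw [Multiset.map_cons, Multiset.sum_cons, ih, Multiset.count_cons]
      push_cast
      exact add_comm _ _
  have := hp p
  rw [hq s (Multiset.le_add_right _ _), hq t (Multiset.le_add_left _ _)] at this
  exact_mod_cast this

theorem Matrix.roots_charpoly_eq_map_of_trace_pow {K ι κ : Type*} [Field K] [IsAlgClosed K]
    [CharZero K] [Fintype ι] [DecidableEq ι] [Fintype κ] (M : Matrix ι ι K) (f : κ → K)
    (h : ∀ m : ℕ, (M ^ m).trace = ∑ i, f i ^ m) :
    M.charpoly.roots = (Finset.univ : Finset κ).val.map f := by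
  refine Multiset.eq_of_sum_map_pow_eq fun m => ?_
  have h2 := M.roots_charpoly_aeval (Polynomial.X ^ m)
  simp only [map_pow, Polynomial.aeval_X, Polynomial.eval_pow, Polynomial.eval_X] at h2
  rw [← h2, ← Matrix.trace_eq_sum_roots_charpoly, h, Multiset.map_map]
  rfl

/-! ### Shuffles as moves of sets of cards -/

theorem Equiv.Perm.eq_of_lt_iff_lt {n : ℕ} {σ τ : Equiv.Perm (Fin n)}
    (h : ∀ c d, σ c < σ d ↔ τ c < τ d) : σ = τ := by
  have h1 : σ * τ⁻¹ = 1 := by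
    refine (Equiv.Perm.monotone_iff _).1 fun a b hab => ?_
    by_contra hlt
    rw [not_le] at hlt
    have := (h (τ⁻¹ b) (τ⁻¹ a)).1 hlt
    simp only [Equiv.Perm.inv_def, Equiv.apply_symm_apply] at this
    exact absurd hab (not_le.2 this)
  exact mul_inv_eq_one.1 h1

theorem Tuple.inv_sort_lt_inv_sort_iff {n : ℕ} {α : Type*} [LinearOrder α] {f : Fin n → α}
    (hf : Function.Injective f) (c d : Fin n) :
    (Tuple.sort f)⁻¹ c < (Tuple.sort f)⁻¹ d ↔ f c < f d := by
  have hm : StrictMono (f ∘ Tuple.sort f) :=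
    (Tuple.monotone_sort f).strictMono_of_injective (hf.comp (Tuple.sort f).injective)
  rw [← hm.lt_iff_lt]
  simp

/-- The arrangement obtained from `σ` (card `c` is in position `σ c`) by moving the cards in `B`
to the top, preserving all other relative orders. -/
noncomputable def moveToTop {n : ℕ} (B : Finset (Fin n)) (σ : Equiv.Perm (Fin n)) :
    Equiv.Perm (Fin n) :=
  (Tuple.sort fun c => if c ∈ B then (σ c : ℕ) else n + σ c)⁻¹

theorem moveToTop_lt_iff {n : ℕ} (B : Finset (Fin n)) (σ : Equiv.Perm (Fin n)) (c d : Fin n) :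
    moveToTop B σ c < moveToTop B σ d ↔
      (c ∈ B ∧ d ∉ B) ∨ ((c ∈ B ↔ d ∈ B) ∧ σ c < σ d) := by
  rw [moveToTop, Tuple.inv_sort_lt_inv_sort_iff]
  · have := (σ c).2
    have := (σ d).2
    rw [Fin.lt_def]
    by_cases hc : c ∈ B <;> by_cases hd : d ∈ B <;> simp [hc, hd] <;> omega
  · intro a b hab
    have := (σ a).2
    have := (σ b).2
    apply σ.injective
    rw [Fin.ext_iff]
    by_cases ha : a ∈ B <;> by_cases hb : b ∈ B <;> simp [ha, hb] at hab ⊢ <;> omega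

theorem Equiv.Perm.mem_iff_lt_card_of_forall_lt {n : ℕ} {B : Finset (Fin n)}
    {τ : Equiv.Perm (Fin n)} (h : ∀ c ∈ B, ∀ d ∉ B, τ c < τ d) (c : Fin n) :
    c ∈ B ↔ (τ c : ℕ) < B.card := by
  constructor
  · intro hc
    have : Finset.Iic (τ c) ⊆ B.image τ := by
      intro e he
      by_contra hne
      have h1 : τ⁻¹ e ∉ B := fun h2 => hne (Finset.mem_image.2 ⟨_, h2, by simp⟩)
      have := h c hc _ h1
      rw [Equiv.Perm.inv_def, Equiv.apply_symm_apply] at this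
      exact absurd (Finset.mem_Iic.1 he) (not_le.2 this)
    have := Finset.card_le_card this
    rw [Fin.card_Iic, Finset.card_image_of_injective _ τ.injective] at this
    omega
  · intro hc
    by_contra hn
    have : B.image τ ⊆ Finset.Iio (τ c) := by
      intro e he
      obtain ⟨b, hb, rfl⟩ := Finset.mem_image.1 he
      exact Finset.mem_Iio.2 (h b hb c hn)
    have := Finset.card_le_card this
    rw [Fin.card_Iio, Finset.card_image_of_injective _ τ.injective] at this
    omega

theorem mem_iff_moveToTop_lt_card {n : ℕ} (B : Finset (Fin n)) (σ : Equiv.Perm (Fin n))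
    (c : Fin n) : c ∈ B ↔ (moveToTop B σ c : ℕ) < B.card :=
  Equiv.Perm.mem_iff_lt_card_of_forall_lt
    (fun c hc d hd => (moveToTop_lt_iff B σ c d).2 (Or.inl ⟨hc, hd⟩)) c

theorem moveToTop_injOn {n : ℕ} (k : ℕ) (σ : Equiv.Perm (Fin n)) :
    Set.InjOn (fun B => moveToTop B σ)
      (Finset.powersetCard k (Finset.univ : Finset (Fin n)) : Set (Finset (Fin n))) := by
  intro B hB B' hB' h
  rw [Finset.mem_coe, Finset.mem_powersetCard_univ] at hB hB'
  ext c
  rw [mem_iff_moveToTop_lt_card B σ, mem_iff_moveToTop_lt_card B' σ, hB, hB']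
  exact Iff.of_eq (congrArg (fun τ : Equiv.Perm (Fin n) => (τ c : ℕ) < k) h)

/-- The positions `A` of a shuffle and the cards `B` correspond by `A = σ(B)`. -/
theorem mul_inv_mem_kShuffles_iff {n k : ℕ} (σ τ : Equiv.Perm (Fin n)) :
    τ * σ⁻¹ ∈ kShuffles n k ↔
      ∃ B ∈ Finset.powersetCard k (Finset.univ : Finset (Fin n)), moveToTop B σ = τ := by
  simp only [kShuffles, Finset.mem_filter, Finset.mem_univ, true_and,
    Finset.mem_powersetCard_univ]
  constructor
  · rintro ⟨A, hA, hlt, hmono, hmono'⟩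
    generalize hs : τ * σ⁻¹ = s at *
    obtain rfl : τ = s * σ := by rw [← hs]; simp
    have himg : A.image s = Finset.univ.filter fun e : Fin n => (e : ℕ) < k := by
      refine Finset.eq_of_subset_of_card_le ?_ ?_
      · intro e he
        obtain ⟨b, hb, rfl⟩ := Finset.mem_image.1 he
        simpa using hlt b hb
      · rw [Finset.card_image_of_injective _ s.injective, hA]
        exact (Fin.card_filter_val_lt).le.trans (min_le_right _ _)
    have hiff : ∀ i, i ∈ A ↔ (s i : ℕ) < k := by
      intro i
      have := congrArg (fun T => s i ∈ T) himg
      simpa using this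
    refine ⟨A.image σ.symm, by
      rw [Finset.card_image_of_injective _ σ.symm.injective, hA], ?_⟩
    have hmem : ∀ c, c ∈ A.image σ.symm ↔ σ c ∈ A := by
      intro c
      simp [Equiv.symm_apply_eq]
    refine Equiv.Perm.eq_of_lt_iff_lt fun c d => ?_
    rw [moveToTop_lt_iff, hmem, hmem, Equiv.Perm.mul_apply, Equiv.Perm.mul_apply]
    by_cases hc : σ c ∈ A <;> by_cases hd : σ d ∈ A
    · simpa [hc, hd] using (hmono.lt_iff_lt hc hd).symm
    · have := (hiff _).1 hc
      have := mt (hiff _).2 hd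
      simp only [hc, hd, Fin.lt_def]
      simp; omega
    · have := (hiff _).1 hd
      have := mt (hiff _).2 hc
      simp only [hc, hd, Fin.lt_def]
      simp; omega
    · simpa [hc, hd] using (hmono'.lt_iff_lt (a := σ c) (b := σ d) hc hd).symm
  · rintro ⟨B, hB, rfl⟩
    have hmem : ∀ i, i ∈ B.image σ ↔ σ⁻¹ i ∈ B := by
      intro i
      simp [Equiv.Perm.inv_def, ← Equiv.eq_symm_apply]
    refine ⟨B.image σ, by rw [Finset.card_image_of_injective _ σ.injective, hB], ?_, ?_, ?_⟩
    · intro i hi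
      rw [hmem, mem_iff_moveToTop_lt_card B σ, hB] at hi
      exact hi
    · intro i hi j hj hij
      rw [Finset.mem_coe, hmem] at hi hj
      rw [Equiv.Perm.mul_apply, Equiv.Perm.mul_apply, moveToTop_lt_iff]
      exact Or.inr ⟨iff_of_true hi hj, by simpa using hij⟩
    · intro i hi j hj hij
      rw [Set.mem_compl_iff, Finset.mem_coe, hmem] at hi hj
      rw [Equiv.Perm.mul_apply, Equiv.Perm.mul_apply, moveToTop_lt_iff]
      exact Or.inr ⟨iff_of_false hi hj, by simpa using hij⟩

theorem card_kShuffles (n k : ℕ) : (kShuffles n k).card = n.choose k := by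
  have : kShuffles n k = (Finset.powersetCard k (Finset.univ : Finset (Fin n))).image
      fun B => moveToTop B 1 := by
    ext τ
    rw [Finset.mem_image, ← mul_inv_mem_kShuffles_iff]
    simp
  rw [this, Finset.card_image_of_injOn (moveToTop_injOn k 1)]
  simp

theorem one_mem_kShuffles {n k : ℕ} (hkn : k ≤ n) : (1 : Equiv.Perm (Fin n)) ∈ kShuffles n k := by
  simp only [kShuffles, Finset.mem_filter, Finset.mem_univ, true_and]
  refine ⟨Finset.univ.filter fun e : Fin n => (e : ℕ) < k, ?_, by simp,
    fun _ _ _ _ h => h, fun _ _ _ _ h => h⟩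
  rw [Fin.card_filter_val_lt, min_eq_right hkn]

/-! ### Arrangements fixed by a word of moves -/

theorem exists_key_foldr_moveToTop {n : ℕ} (l : List (Finset (Fin n))) :
    ∃ f : Fin n → ℕ, (∀ c d, f c = f d ↔ ∀ B ∈ l, (c ∈ B ↔ d ∈ B)) ∧
      ∀ σ c d, l.foldr moveToTop σ c < l.foldr moveToTop σ d ↔
        f c < f d ∨ (f c = f d ∧ σ c < σ d) := by
  induction l with
  | nil => exact ⟨fun _ => 0, by simp, by simp⟩
  | cons B l ih =>
    obtain ⟨f, hf, hlt⟩ := ih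
    -- `N` exceeds every old key, so the head of the word, applied last, becomes the most
    -- significant digit.
    let N := Finset.univ.sup f + 1
    have hN : ∀ c, f c < N := fun c => Nat.lt_succ_of_le (Finset.le_sup (Finset.mem_univ c))
    refine ⟨fun c => if c ∈ B then f c else N + f c, fun c d => ?_, fun σ c d => ?_⟩
    · have := hN c
      have := hN d
      rw [List.forall_mem_cons, ← hf]
      by_cases hc : c ∈ B <;> by_cases hd : d ∈ B <;> simp [hc, hd] <;> omega
    · have := hN c
      have := hN d
      rw [List.foldr_cons, moveToTop_lt_iff, hlt]
      by_cases hc : c ∈ B <;> by_cases hd : d ∈ B <;> simp [hc, hd] <;> omega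

/-- For sorted `σ₀` and `σ`, reading the keys by position gives the same monotone sequence, so `σ₀⁻¹
* σ` preserves keys. -/
theorem Equiv.Perm.card_filter_key_lt_imp_lt {n : ℕ} (f : Fin n → ℕ) {σ₀ : Equiv.Perm (Fin n)}
    (h₀ : ∀ c d, f c < f d → σ₀ c < σ₀ d) :
    (Finset.univ.filter fun σ : Equiv.Perm (Fin n) => ∀ c d, f c < f d → σ c < σ d).card =
      (Finset.univ.filter fun τ : Equiv.Perm (Fin n) => ∀ c, f (τ c) = f c).card := by
  have hmono : ∀ σ : Equiv.Perm (Fin n), (∀ c d, f c < f d → σ c < σ d) →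
      Monotone (f ∘ (σ⁻¹ : Equiv.Perm (Fin n))) := by
    intro σ h a b hab
    by_contra hlt
    have := h _ _ (not_le.1 hlt)
    simp only [Equiv.Perm.inv_def, Equiv.apply_symm_apply] at this
    exact absurd hab (not_le.2 this)
  refine Finset.card_bij (fun σ _ => σ₀⁻¹ * σ) ?_ (fun _ _ _ _ h => mul_left_cancel h) ?_
  · intro σ hσ
    rw [Finset.mem_filter] at hσ ⊢
    refine ⟨Finset.mem_univ _, fun c => ?_⟩
    have := congrFun (Tuple.unique_monotone (hmono σ₀ h₀) (hmono σ hσ.2)) (σ c)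
    simpa using this
  · intro τ hτ
    rw [Finset.mem_filter] at hτ
    refine ⟨σ₀ * τ, ?_, by simp⟩
    rw [Finset.mem_filter]
    refine ⟨Finset.mem_univ _, fun c d h => h₀ _ _ ?_⟩
    rwa [hτ.2, hτ.2]

theorem Finset.image_perm_eq_self_iff {α : Type*} [DecidableEq α] (τ : Equiv.Perm α)
    (B : Finset α) : B.image τ = B ↔ ∀ c, τ c ∈ B ↔ c ∈ B := by
  constructor
  · intro h c
    conv_lhs => rw [← h]
    simp
  · intro h
    refine Finset.eq_of_subset_of_card_le ?_ (Finset.card_image_of_injective _ τ.injective).ge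
    intro e he
    obtain ⟨b, hb, rfl⟩ := Finset.mem_image.1 he
    exact (h b).2 hb

theorem card_fixed_foldr_moveToTop {n : ℕ} (l : List (Finset (Fin n))) :
    (Finset.univ.filter fun σ : Equiv.Perm (Fin n) => l.foldr moveToTop σ = σ).card =
      (Finset.univ.filter fun τ : Equiv.Perm (Fin n) => ∀ B ∈ l, B.image τ = B).card := by
  obtain ⟨f, hf, hlt⟩ := exists_key_foldr_moveToTop l
  have h := Equiv.Perm.card_filter_key_lt_imp_lt f (σ₀ := l.foldr moveToTop 1)
    fun c d hcd => (hlt 1 c d).2 (Or.inl hcd)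
  convert h using 2
  · refine Finset.filter_congr fun σ _ => ?_
    constructor
    · intro hσ c d hcd
      rw [← hσ]
      exact (hlt σ c d).2 (Or.inl hcd)
    · intro hσ
      refine Equiv.Perm.eq_of_lt_iff_lt fun c d => ?_
      rw [hlt]
      have := hσ c d
      have := hσ d c
      constructor
      · rintro (h | h)
        · exact hσ c d h
        · exact h.2
      · intro h
        rcases lt_trichotomy (f c) (f d) with h' | h' | h'
        · exact Or.inl h'
        · exact Or.inr ⟨h', h⟩
        · exact absurd (hσ d c h') h.asymm
  · refine Finset.filter_congr fun τ _ => ?_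
    simp only [hf, Finset.image_perm_eq_self_iff]
    exact ⟨fun h c B hB => h B hB c, fun h B hB c => h c B hB⟩

/-! ### Traces of powers and the spectrum -/

theorem Matrix.pow_apply_eq_sum_foldr {R α β : Type*} [Semiring R] [Fintype α] [Fintype β]
    [DecidableEq β] (act : α → β → β) (m : ℕ) (x y : β) :
    ((Matrix.of fun x y => ∑ a, if act a x = y then (1 : R) else 0) ^ m) x y =
      ∑ w : Fin m → α, if (List.ofFn w).foldr act x = y then 1 else 0 := by
  induction m generalizing y with
  | zero => simp [Matrix.one_apply]
  | succ m ih =>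
    -- The last step of a walk is the head of its word.
    rw [pow_succ, Matrix.mul_apply, ← (Fin.consEquiv fun _ : Fin (m + 1) => α).sum_comp,
      Fintype.sum_prod_type_right]
    simp only [ih, Matrix.of_apply, Finset.sum_mul_sum]
    rw [Finset.sum_comm]
    refine Finset.sum_congr rfl fun w _ => ?_
    rw [Finset.sum_comm]
    refine Finset.sum_congr rfl fun a _ => ?_
    rw [Finset.sum_eq_single ((List.ofFn w).foldr act x)]
    · simp [Fin.consEquiv, List.ofFn_succ]
    · intro b _ hb
      simp [hb.symm]
    · simp

/-- The unnormalised transition matrix of the uniform `k`-shuffle chain. -/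
noncomputable def kShuffleCount (n k : ℕ) :
    Matrix (Equiv.Perm (Fin n)) (Equiv.Perm (Fin n)) ℂ :=
  Matrix.of fun σ τ => if τ * σ⁻¹ ∈ kShuffles n k then 1 else 0

theorem kShuffleCount_eq (n k : ℕ) : kShuffleCount n k = Matrix.of fun σ τ =>
    ∑ B : Finset.powersetCard k (Finset.univ : Finset (Fin n)),
      if moveToTop (B : Finset (Fin n)) σ = τ then (1 : ℂ) else 0 := by
  ext σ τ
  simp only [kShuffleCount, Matrix.of_apply, mul_inv_mem_kShuffles_iff]
  rw [Finset.sum_coe_sort (Finset.powersetCard k (Finset.univ : Finset (Fin n)))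
    fun B => if moveToTop B σ = τ then (1 : ℂ) else 0]
  split_ifs with h
  · obtain ⟨B, hB, rfl⟩ := h
    rw [Finset.sum_eq_single_of_mem B hB, if_pos rfl]
    intro B' hB' hne
    exact if_neg fun h => hne (moveToTop_injOn k σ hB' hB h)
  · exact (Finset.sum_eq_zero fun B hB => if_neg fun hB' => h ⟨B, hB, hB'⟩).symm

theorem trace_kShuffleCount_pow (n k m : ℕ) :
    (kShuffleCount n k ^ m).trace =
      ∑ τ : Equiv.Perm (Fin n), (fixedKSubsets k τ : ℂ) ^ m := by
  rw [kShuffleCount_eq, Matrix.trace]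
  simp only [Matrix.diag_apply, Matrix.pow_apply_eq_sum_foldr]
  rw [Finset.sum_comm]
  let S := Finset.powersetCard k (Finset.univ : Finset (Fin n))
  have h1 : ∀ w : Fin m → S, (∑ σ : Equiv.Perm (Fin n),
      if (List.ofFn w).foldr (fun B : S => moveToTop (B : Finset (Fin n))) σ = σ then (1 : ℂ) else 0) =
      ∑ τ : Equiv.Perm (Fin n),
        if ∀ i, (w i : Finset (Fin n)).image τ = w i then (1 : ℂ) else 0 := by
    intro w
    have := card_fixed_foldr_moveToTop ((List.ofFn w).map Subtype.val)
    simp only [List.foldr_map, List.mem_map, List.mem_ofFn] at this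
    rw [Finset.sum_boole, Finset.sum_boole]
    rw [this]
    congr 2
    ext τ
    simp
  rw [Finset.sum_congr rfl fun w _ => h1 w, Finset.sum_comm]
  refine Finset.sum_congr rfl fun τ _ => ?_
  have h2 : (fixedKSubsets k τ : ℂ) =
      ∑ B : S, if (B : Finset (Fin n)).image τ = B then 1 else 0 := by
    rw [fixedKSubsets, ← Finset.sum_boole]
    exact (Finset.sum_coe_sort S fun B => if B.image τ = B then (1 : ℂ) else 0).symm
  -- The `m`-th power expands into a count of words of `m` sets, each fixed by `τ`.
  rw [h2, ← Fin.prod_const, Finset.prod_univ_sum]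
  simp only [Fintype.piFinset_univ, Finset.prod_boole, Finset.mem_univ, true_imp_iff]

theorem roots_charpoly_kShuffleCount (n k : ℕ) :
    (kShuffleCount n k).charpoly.roots =
      (Finset.univ : Finset (Equiv.Perm (Fin n))).val.map fun τ => (fixedKSubsets k τ : ℂ) :=
  Matrix.roots_charpoly_eq_map_of_trace_pow _ _ (trace_kShuffleCount_pow n k)

theorem proposition3p1 (n k : ℕ) (hk : 1 ≤ k) (hkn : k ≤ n) :
    eigenvalueMultiset (kShuffleMatrix n k) =
      (Finset.univ : Finset (Equiv.Perm (Fin n))).val.map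
        (fun τ => (fixedKSubsets k τ : ℂ) / (n.choose k : ℂ)) ∧
    (2 ≤ n → k < n →
      eigenvalueMultiset (kShuffleMatrix' n k) =
        (Finset.univ : Finset (Equiv.Perm (Fin n))).val.map
          (fun τ => ((fixedKSubsets k τ : ℂ) - 1) / ((n.choose k : ℂ) - 1))) := by
  constructor
  · have h : (kShuffleMatrix n k).map (algebraMap ℝ ℂ) =
        Polynomial.aeval (kShuffleCount n k) (Polynomial.C ((n.choose k : ℂ)⁻¹) * Polynomial.X) := by
      rw [map_mul, Polynomial.aeval_C, Polynomial.aeval_X, ← Algebra.smul_def]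
      ext σ τ
      simp [kShuffleMatrix, uniformChain, kShuffleCount, card_kShuffles]
      split_ifs <;> simp
    rw [eigenvalueMultiset, h, Matrix.roots_charpoly_aeval, roots_charpoly_kShuffleCount,
      Multiset.map_map]
    refine Multiset.map_congr rfl fun τ _ => ?_
    simp [div_eq_inv_mul]
  · intro _ _
    -- Excluding the identity shuffle subtracts the identity matrix from the count.
    have h : (kShuffleMatrix' n k).map (algebraMap ℝ ℂ) =
        Polynomial.aeval (kShuffleCount n k) (Polynomial.C (((n.choose k : ℂ) - 1)⁻¹) * (Polynomial.X - 1)) := by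
      rw [map_mul, map_sub, Polynomial.aeval_C, Polynomial.aeval_X, map_one, ← Algebra.smul_def]
      ext σ τ
      have hone : τ * σ⁻¹ = 1 ↔ σ = τ := by rw [mul_inv_eq_one, eq_comm]
      have hpos := Nat.choose_pos hkn
      by_cases hst : σ = τ
      · subst hst
        simp [kShuffleMatrix', uniformChain, kShuffleCount, one_mem_kShuffles hkn]
      · simp [kShuffleMatrix', uniformChain, kShuffleCount, card_kShuffles,
          Finset.card_erase_of_mem (one_mem_kShuffles hkn), Nat.cast_sub hpos, hone, hst]
        split_ifs <;> simp
    rw [eigenvalueMultiset, h, Matrix.roots_charpoly_aeval, roots_charpoly_kShuffleCount,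
      Multiset.map_map]
    refine Multiset.map_congr rfl fun τ _ => ?_
    simp [div_eq_inv_mul]
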